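/- For every integer $d \ge 2$ there exists a compact set $K \subseteq [0,1]^d$ such that for every hyperplane (that is, every $(d-1)$-dimensional affine subspace) $H \subseteq \mathbb{R}^d$, the orthogonal projection of $K$ onto $H$ has non-empty interior relative to $H$, while the sumset $K+K=\{x+y : x,y\in K\}$ is nowhere dense in $\mathbb{R}^d$. -/

import Mathlib

open scoped Pointwise

/-! `K` is a finite union of compact pieces `barrier … u`, one for each `u` in a finite 1/4-net `S`
of the unit sphere. The `n`-th triple `(q, v, w)` of an enumeration of (countable dense set) × `S` ×
`S` confines the pieces of `v` and `w` to thin periodic layers with a common normal `g`, placed so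
that no two of their points sum to `q` (`add_ne_of_mem_layers`). Hence `K + K` is closed and misses
a dense set.

As `g` bisects the lines of `v` and `w`, it is transverse to all directions near either. Along a
line of direction near `u`, every layer condition is thus a congruence with slope bounded above and
below; since the periods decrease rapidly, all can be met at once
(`exists_simultaneously_near_lattice`). So `K` meets every line near its centre, which gives the
projections interior. -/

/-- The step sizes `(1/8) * 17⁻ⁿ`, each of which is 16 times the sum of all later ones. -/
noncomputable def stepSize (n : ℕ) : ℝ := 1 / 8 * (1 / 17) ^ n

lemma stepSize_pos (n : ℕ) : 0 < stepSize n := by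
  unfold stepSize; positivity

/-- The point of `ℝ` at which `s ↦ a + b * s` attains the value of `α + ρ ℤ` nearest to
`a + b * t`. -/
noncomputable def latticeStep (a b α ρ t : ℝ) : ℝ :=
  (α + round ((a + b * t - α) / ρ) * ρ - a) / b

lemma abs_sub_latticeStep_le {a b α ρ t : ℝ} (hρ : 0 < ρ) (hb : 1 / 2 ≤ |b|) :
    |t - latticeStep a b α ρ t| ≤ ρ := by
  have hb0 : b ≠ 0 := by
    rintro rfl
    norm_num at hb
  have key : b * (t - latticeStep a b α ρ t) =
      ρ * ((a + b * t - α) / ρ - round ((a + b * t - α) / ρ)) := by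
    unfold latticeStep
    field_simp
    ring
  have h1 := abs_sub_round ((a + b * t - α) / ρ)
  have h2 : |b| * |t - latticeStep a b α ρ t| ≤ ρ * (1 / 2) := by
    rw [← abs_mul, key, abs_mul, abs_of_pos hρ]
    gcongr
  nlinarith [abs_nonneg (t - latticeStep a b α ρ t)]

lemma latticeStep_spec {a b α ρ t : ℝ} (hb : 1 / 2 ≤ |b|) :
    a + b * latticeStep a b α ρ t = α + round ((a + b * t - α) / ρ) * ρ := by
  have hb0 : b ≠ 0 := by
    rintro rfl
    norm_num at hb
  unfold latticeStep
  field_simp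
  ring

/-- The successive solutions of the congruences `a n + b n * t ∈ α n + stepSize n * ℤ`. -/
noncomputable def latticeSeq (a b α : ℕ → ℝ) : ℕ → ℝ
  | 0 => 0
  | n + 1 => latticeStep (a n) (b n) (α n) (stepSize n) (latticeSeq a b α n)

lemma UnitAddCircle.norm_coe_le (y : ℝ) (m : ℤ) : ‖(y : UnitAddCircle)‖ ≤ |y - m| := by
  rw [UnitAddCircle.norm_eq]
  exact round_le y m

/-- Affine functions with slopes bounded above and below can simultaneously be brought close to
given lattices of rapidly decreasing mesh. -/
lemma exists_simultaneously_near_lattice (a b α : ℕ → ℝ) (hb : ∀ n, 1 / 2 ≤ |b n|)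
    (hb' : ∀ n, |b n| ≤ 2) :
    ∃ t : ℝ, |t| ≤ 1 / 4 ∧
      ∀ n, ‖(((a n + b n * t - α n) / stepSize n : ℝ) : UnitAddCircle)‖ ≤ 1 / 8 := by
  have hstep : ∀ n, dist (latticeSeq a b α n) (latticeSeq a b α (n + 1)) ≤
      1 / 8 * (1 / 17) ^ n := fun n =>
    abs_sub_latticeStep_le (stepSize_pos n) (hb n)
  obtain ⟨t, ht⟩ := cauchySeq_tendsto_of_complete
    (cauchySeq_of_le_geometric (1 / 17) (1 / 8) (by norm_num) hstep)
  have hdist := dist_le_of_le_geometric_of_tendsto (1 / 17) (1 / 8) (by norm_num) hstep ht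
  refine ⟨t, ?_, fun n => ?_⟩
  · have h := hdist 0
    simp only [latticeSeq, Real.dist_eq, zero_sub, abs_neg] at h
    norm_num at h
    linarith
  -- Term `n + 1` solves the `n`-th congruence exactly; only the later corrections disturb it. Their
  -- sum is at most `stepSize n / 16`, and a slope of at most 2 turns this into the tolerance 1/8.
  · have h := hdist (n + 1)
    have hρ := stepSize_pos n
    refine (UnitAddCircle.norm_coe_le _
      (round ((a n + b n * latticeSeq a b α n - α n) / stepSize n))).trans ?_
    have hs := latticeStep_spec (a := a n) (α := α n) (ρ := stepSize n)
      (t := latticeSeq a b α n) (hb n)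
    change a n + b n * latticeSeq a b α (n + 1) = _ at hs
    have hval : (a n + b n * t - α n) / stepSize n -
        round ((a n + b n * latticeSeq a b α n - α n) / stepSize n) =
        b n * (t - latticeSeq a b α (n + 1)) / stepSize n := by
      rw [eq_div_iff hρ.ne', sub_mul, div_mul_cancel₀ _ hρ.ne']
      linarith
    rw [hval, abs_div, abs_of_pos hρ, div_le_iff₀ hρ, abs_mul, abs_sub_comm]
    have hle : |latticeSeq a b α (n + 1) - t| ≤ stepSize n / 16 := by
      refine h.trans (le_of_eq ?_)
      unfold stepSize
      rw [pow_succ]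
      ring
    calc |b n| * |latticeSeq a b α (n + 1) - t| ≤ 2 * (stepSize n / 16) := by
          gcongr
          exact hb' n
      _ = 1 / 8 * stepSize n := by ring

section Barrier

variable {E : Type*} [NormedAddCommGroup E] [InnerProductSpace ℝ E]

open Classical in
/-- A vector bisecting the smaller angle formed by the lines spanned by `v` and `w`. -/
noncomputable def lineBisector (v w : E) : E :=
  if 0 ≤ inner ℝ v w then v + w else v - w

lemma norm_lineBisector_le {v w : E} (hv : ‖v‖ = 1) (hw : ‖w‖ = 1) :
    ‖lineBisector v w‖ ≤ 2 := by
  unfold lineBisector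
  split_ifs
  · have := norm_add_le v w
    linarith
  · have := norm_sub_le v w
    linarith

/-- The sign in the bisector makes this inner product `1 + |⟪v, w⟫|`. -/
lemma one_le_abs_inner_lineBisector_left {v w : E} (hv : ‖v‖ = 1) :
    1 ≤ |inner ℝ (lineBisector v w) v| := by
  unfold lineBisector
  split_ifs with h
  · rw [inner_add_left, real_inner_self_eq_norm_sq, hv, real_inner_comm]
    refine le_trans ?_ (le_abs_self _)
    linarith
  · rw [inner_sub_left, real_inner_self_eq_norm_sq, hv, real_inner_comm]
    refine le_trans ?_ (le_abs_self _)
    linarith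

lemma one_le_abs_inner_lineBisector_right {v w : E} (hw : ‖w‖ = 1) :
    1 ≤ |inner ℝ (lineBisector v w) w| := by
  unfold lineBisector
  split_ifs with h
  · rw [inner_add_left, real_inner_self_eq_norm_sq, hw]
    refine le_trans ?_ (le_abs_self _)
    linarith
  · rw [inner_sub_left, real_inner_self_eq_norm_sq, hw]
    refine le_trans ?_ (neg_le_abs _)
    linarith

open Classical in
/-- The normal vector of the layers used for the direction `u` when the pair of directions
`v`, `w` is being treated. -/
noncomputable def layerNormal (v w u : E) : E :=
  if u = v ∨ u = w then lineBisector v w else u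

lemma norm_layerNormal_le {v w u : E} (hv : ‖v‖ = 1) (hw : ‖w‖ = 1) (hu : ‖u‖ = 1) :
    ‖layerNormal v w u‖ ≤ 2 := by
  unfold layerNormal
  split_ifs
  · exact norm_lineBisector_le hv hw
  · linarith

lemma one_le_abs_inner_layerNormal {v w u : E} (hu : ‖u‖ = 1) :
    1 ≤ |inner ℝ (layerNormal v w u) u| := by
  unfold layerNormal
  split_ifs with h
  · rcases h with rfl | rfl
    · exact one_le_abs_inner_lineBisector_left hu
    · exact one_le_abs_inner_lineBisector_right hu
  · rw [real_inner_self_eq_norm_sq, hu]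
    norm_num

lemma half_le_abs_inner_of_norm_sub_le {g u θ : E} (hg : ‖g‖ ≤ 2) (hgu : 1 ≤ |inner ℝ g u|)
    (hθ : ‖θ - u‖ ≤ 1 / 4) : 1 / 2 ≤ |inner ℝ g θ| := by
  have h1 : |inner ℝ g (θ - u)| ≤ 2 * (1 / 4) :=
    (abs_real_inner_le_norm _ _).trans (by gcongr)
  have h2 : |inner ℝ g u| ≤ |inner ℝ g θ| + |inner ℝ g (θ - u)| := by
    have : inner ℝ g u = inner ℝ g θ - inner ℝ g (θ - u) := by
      rw [inner_sub_right]
      ring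
    rw [this]
    exact abs_sub _ _
  linarith

/-- The offset of the layers orthogonal to `g` which keeps the sums of two points in layers away
from `q`. -/
noncomputable def layerOffset (g q : E) (n : ℕ) : ℝ := inner ℝ g q / 2 + stepSize n / 4

/-- The union of the thin layers orthogonal to `g`, of period `stepSize n`, associated to `q`. -/
def layers (g q : E) (n : ℕ) : Set E :=
  {x | ‖(((inner ℝ g x - layerOffset g q n) / stepSize n : ℝ) : UnitAddCircle)‖ ≤ 1 / 8}

lemma isClosed_layers (g q : E) (n : ℕ) : IsClosed (layers g q n) := by
  refine isClosed_le ?_ continuous_const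
  refine continuous_norm.comp ((AddCircle.continuous_mk' 1).comp ?_)
  fun_prop

lemma add_ne_of_mem_layers {g q x y : E} {n : ℕ} (hx : x ∈ layers g q n)
    (hy : y ∈ layers g q n) : x + y ≠ q := by
  rintro rfl
  have hρ := stepSize_pos n
  -- The quarter-period offsets add up to half a period, at distance 1/2 from the integers, whereas
  -- two tolerances of 1/8 reach only 1/4.
  have hsum : (inner ℝ g x - layerOffset g (x + y) n) / stepSize n +
      (inner ℝ g y - layerOffset g (x + y) n) / stepSize n = -(1 / 2) := by
    unfold layerOffset
    rw [inner_add_right]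
    field_simp
    ring
  have h := norm_add_le
    (((inner ℝ g x - layerOffset g (x + y) n) / stepSize n : ℝ) : UnitAddCircle)
    (((inner ℝ g y - layerOffset g (x + y) n) / stepSize n : ℝ) : UnitAddCircle)
  rw [← AddCircle.coe_add, hsum, AddCircle.coe_neg, norm_neg,
    AddCircle.norm_half_period_eq] at h
  simp only [layers, Set.mem_ofPred_eq] at hx hy
  norm_num at h
  linarith

/-- The part of the ball of radius `1/2` about `c` which meets all lines near `c` with directions
near `u`, built from layers adapted to the points `q n` and the pairs `v n`, `w n`. -/
def barrier (c : E) (q v w : ℕ → E) (u : E) : Set E :=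
  Metric.closedBall c (1 / 2) ∩ ⋂ n, layers (layerNormal (v n) (w n) u) (q n) n

lemma isCompact_barrier [ProperSpace E] (c : E) (q v w : ℕ → E) (u : E) :
    IsCompact (barrier c q v w u) :=
  (isCompact_closedBall c (1 / 2)).inter_right (isClosed_iInter fun _ => isClosed_layers _ _ _)

lemma add_ne_of_mem_barrier {c : E} {q v w : ℕ → E} {x y : E} {n : ℕ}
    (hx : x ∈ barrier c q v w (v n)) (hy : y ∈ barrier c q v w (w n)) : x + y ≠ q n := by
  have hx' := Set.mem_iInter.1 hx.2 n
  have hy' := Set.mem_iInter.1 hy.2 n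
  rw [layerNormal, if_pos (Or.inl rfl)] at hx'
  rw [layerNormal, if_pos (Or.inr rfl)] at hy'
  exact add_ne_of_mem_layers hx' hy'

lemma exists_add_smul_mem_barrier {c : E} {q v w : ℕ → E} {u x θ : E} (hv : ∀ n, ‖v n‖ = 1)
    (hw : ∀ n, ‖w n‖ = 1) (hu : ‖u‖ = 1) (hθ : ‖θ‖ = 1) (hθu : ‖θ - u‖ ≤ 1 / 4)
    (hx : ‖x - c‖ ≤ 1 / 4) : ∃ t : ℝ, x + t • θ ∈ barrier c q v w u := by
  have hg : ∀ n, ‖layerNormal (v n) (w n) u‖ ≤ 2 := fun n =>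
    norm_layerNormal_le (hv n) (hw n) hu
  obtain ⟨t, ht, h⟩ := exists_simultaneously_near_lattice
    (fun n => inner ℝ (layerNormal (v n) (w n) u) x)
    (fun n => inner ℝ (layerNormal (v n) (w n) u) θ)
    (fun n => layerOffset (layerNormal (v n) (w n) u) (q n) n)
    (fun n => half_le_abs_inner_of_norm_sub_le (hg n) (one_le_abs_inner_layerNormal hu) hθu)
    (fun n => (abs_real_inner_le_norm _ _).trans (by rw [hθ, mul_one]; exact hg n))
  refine ⟨t, ?_, Set.mem_iInter.2 fun n => ?_⟩
  · rw [mem_closedBall_iff_norm]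
    calc ‖x + t • θ - c‖ = ‖(x - c) + t • θ‖ := by congr 1; abel
      _ ≤ ‖x - c‖ + ‖t • θ‖ := norm_add_le _ _
      _ ≤ 1 / 4 + 1 / 4 := by
        rw [norm_smul, hθ, mul_one]
        exact add_le_add hx ht
      _ = 1 / 2 := by norm_num
  · have hn := h n
    simp only [layers, Set.mem_ofPred_eq, inner_add_right, inner_smul_right]
    rwa [mul_comm t]

end Barrier

/-- A compact subset of the ball of radius `1/2` which meets all lines near the centre, but whose
sumset with itself is nowhere dense. -/
lemma exists_isCompact_meeting_lines_isNowhereDense_add {E : Type*} [NormedAddCommGroup E]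
    [InnerProductSpace ℝ E] [FiniteDimensional ℝ E] (c : E) :
    ∃ K ⊆ Metric.closedBall c (1 / 2), IsCompact K ∧
      (∀ x θ : E, ‖x - c‖ ≤ 1 / 4 → ‖θ‖ = 1 → ∃ t : ℝ, x + t • θ ∈ K) ∧
      IsNowhereDense (K + K) := by
  have : ProperSpace E := FiniteDimensional.proper ℝ E
  obtain ⟨S, hS, hSfin, hcover⟩ := (isCompact_sphere (0 : E) 1).finite_cover_balls
    (show (0 : ℝ) < 1 / 4 by norm_num)
  have hS1 : ∀ u ∈ S, ‖u‖ = 1 := fun u hu => by simpa using hS hu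
  -- An empty net means that there are no unit vectors, so the empty set works.
  rcases S.eq_empty_or_nonempty with rfl | hne
  · refine ⟨∅, by simp, isCompact_empty, fun x θ _ hθ => ?_, by simp⟩
    have := hcover (show θ ∈ Metric.sphere (0 : E) 1 by simpa using hθ)
    simp at this
  have : Countable S := hSfin.countable.to_subtype
  have : Nonempty S := hne.to_subtype
  obtain ⟨Q, hQc, hQd⟩ := TopologicalSpace.exists_countable_dense E
  have : Countable Q := hQc.to_subtype
  have : Nonempty Q := hQd.nonempty.to_subtype
  obtain ⟨e, he⟩ := exists_surjective_nat (Q × S × S)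
  set K : Set E := ⋃ u ∈ S, barrier c (fun n => ((e n).1 : E)) (fun n => ((e n).2.1 : E))
    (fun n => ((e n).2.2 : E)) u with hK
  have hKc : IsCompact K := hSfin.isCompact_biUnion fun u _ => isCompact_barrier _ _ _ _ _
  refine ⟨K, Set.iUnion₂_subset fun u _ => Set.inter_subset_left, hKc, fun x θ hx hθ => ?_, ?_⟩
  · have hmem := hcover (show θ ∈ Metric.sphere (0 : E) 1 by simpa using hθ)
    simp only [Set.mem_iUnion, exists_prop, mem_ball_iff_norm] at hmem
    obtain ⟨u, hu, hθu⟩ := hmem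
    obtain ⟨t, ht⟩ := exists_add_smul_mem_barrier (c := c) (q := fun n => ((e n).1 : E))
      (fun n => hS1 _ (e n).2.1.2) (fun n => hS1 _ (e n).2.2.2) (hS1 u hu) hθ hθu.le hx
    exact ⟨t, Set.mem_iUnion₂.2 ⟨u, hu, ht⟩⟩
  · rw [(hKc.add hKc).isClosed.isNowhereDense_iff, Set.eq_empty_iff_forall_notMem]
    intro p hp
    obtain ⟨q, hq, hqQ⟩ := hQd.inter_open_nonempty _ isOpen_interior ⟨p, hp⟩
    obtain ⟨x, hx, y, hy, hxy⟩ := Set.mem_add.1 (interior_subset hq)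
    obtain ⟨v, hv, hxv⟩ := Set.mem_iUnion₂.1 hx
    obtain ⟨w, hw, hyw⟩ := Set.mem_iUnion₂.1 hy
    obtain ⟨n, hn⟩ := he (⟨q, hqQ⟩, ⟨v, hv⟩, ⟨w, hw⟩)
    obtain ⟨hnq, hnv, hnw⟩ : ((e n).1 : E) = q ∧ ((e n).2.1 : E) = v ∧ ((e n).2.2 : E) = w := by
      simp [hn]
    rw [← hnv] at hxv
    rw [← hnw] at hyw
    exact add_ne_of_mem_barrier hxv hyw (hxy.trans hnq.symm)

/-- If `K` meets all lines of unit direction near `c`, then its orthogonal projection to any proper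
affine subspace has interior points. -/
lemma interior_image_orthogonalProjection_nonempty {E : Type*} [NormedAddCommGroup E]
    [InnerProductSpace ℝ E] [FiniteDimensional ℝ E] {K : Set E} {c : E}
    (hK : ∀ x θ : E, ‖x - c‖ ≤ 1 / 4 → ‖θ‖ = 1 → ∃ t : ℝ, x + t • θ ∈ K)
    (H : AffineSubspace ℝ E) [Nonempty H] (hH : H.direction ≠ ⊤) :
    (interior ((fun x => EuclideanGeometry.orthogonalProjection H x) '' K : Set H)).Nonempty := by
  obtain ⟨η, hη, hη0⟩ := Submodule.exists_mem_ne_zero_of_ne_bot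
    (mt Submodule.orthogonal_eq_bot_iff.1 hH)
  have hθ : (‖η‖⁻¹ • η) ∈ H.directionᗮ := Submodule.smul_mem _ _ hη
  have hθ1 : ‖‖η‖⁻¹ • η‖ = 1 := norm_smul_inv_norm (𝕜 := ℝ) hη0
  set p₀ := EuclideanGeometry.orthogonalProjection H c with hp₀
  refine ⟨p₀, mem_interior.2 ⟨Metric.ball p₀ (1 / 4), fun p hp => ?_, Metric.isOpen_ball,
    Metric.mem_ball_self (by norm_num)⟩⟩
  have hpd : ‖(p : E) - p₀‖ < 1 / 4 := by
    rw [← dist_eq_norm]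
    exact hp
  -- The point `c + (p - p₀)` is within 1/4 of `c` and projects to `p`, as does the whole line
  -- through it in the normal direction.
  obtain ⟨t, ht⟩ := hK (c + ((p : E) - p₀)) (‖η‖⁻¹ • η) (by simpa using hpd.le) hθ1
  refine ⟨_, ht, Subtype.ext ?_⟩
  rw [EuclideanGeometry.coe_orthogonalProjection_eq_iff_mem]
  refine ⟨p.2, ?_⟩
  have hc := EuclideanGeometry.vsub_orthogonalProjection_mem_direction_orthogonal H c
  have := Submodule.add_mem _ hc (Submodule.smul_mem _ t hθ)
  convert this using 1
  simp only [vsub_eq_sub, ← hp₀]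
  abel

theorem theoremt (d : ℕ) (hd : 2 ≤ d) :
    ∃ K : Set (EuclideanSpace ℝ (Fin d)),
      IsCompact K ∧
      (∀ x ∈ K, ∀ i : Fin d, x i ∈ Set.Icc (0 : ℝ) 1) ∧
      (∀ (H : AffineSubspace ℝ (EuclideanSpace ℝ (Fin d))) [Nonempty H],
        Module.finrank ℝ H.direction + 1 = d →
          (interior ((fun x => EuclideanGeometry.orthogonalProjection H x) '' K :
            Set H)).Nonempty) ∧
      IsNowhereDense (K + K) := by
  obtain ⟨K, hKball, hKc, hKl, hKn⟩ := exists_isCompact_meeting_lines_isNowhereDense_add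
    (WithLp.toLp 2 (fun _ => 1 / 2) : EuclideanSpace ℝ (Fin d))
  refine ⟨K, hKc, fun x hx i => ?_, fun H _ hH => ?_, hKn⟩
  · have h1 := mem_closedBall_iff_norm.1 (hKball hx)
    have h2 := (PiLp.norm_apply_le (x - WithLp.toLp 2 (fun _ => 1 / 2)) i).trans h1
    simp only [PiLp.sub_apply, Real.norm_eq_abs, abs_le] at h2
    constructor <;> linarith [h2.1, h2.2]
  -- A full direction space would give `d + 1 = d`.
  · refine interior_image_orthogonalProjection_nonempty hKl H fun htop => ?_
    rw [htop, finrank_top, finrank_euclideanSpace_fin] at hH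
    omega
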